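/- For a permutation $\pi$ of $\{1,\dots,n\}$ (where $n\ge 0$), write $|\pi|=n$ and let $\mathrm{fp}(\pi)=\#\{i:\pi(i)=i\}$ be its number of fixed points, $\mathrm{exc}(\pi)=\#\{i: i<\pi(i)\}$ its number of excedances, $\mathrm{dexc}(\pi)=\#\{i: i<\pi(i)<\pi(\pi(i))\}$ its number of double excedances, $\mathrm{cyc}(\pi)$ its number of cycles (fixed points counted as cycles), and $\mathrm{inv}(\pi)=\#\{(i,j): i<j,\ \pi(i)>\pi(j)\}$ its number of inversions. An involution is a permutation equal to its inverse. A permutation $\pi$ is $321$-avoiding if there are no $i<j<k$ with $\pi(i)>\pi(j)>\pi(k)$. Write $[h]_{p}=1+p+\dots+p^{h-1}$. For sequences $\mathbf d=(d_1,d_2,\dots)$ and $\boldsymbol\ell=(\ell_0,\ell_1,\dots)$ in a commutative ring $R$, let $$J_{\mathbf d,\boldsymbol\ell}(z)=\cfrac{1}{1-\ell_0z-\cfrac{d_1z^2}{1-\ell_1z-\cfrac{d_2z^2}{1-\ell_2z-\cdots}}}\in R[[z]],$$ the coefficientwise limit of the finite truncations of the continued fraction. Let $x,v,t,q$ be elements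 of a commutative ring $R$ (for instance independent variables). Involutions have no double excedances, that is, $\mathrm{dexc}(\pi)=0$ for every involution $\pi$. Moreover, as formal power series in $z$: (1) $\displaystyle\sum_{\pi\ \text{involution}} x^{\mathrm{fp}(\pi)}v^{\mathrm{exc}(\pi)}t^{\mathrm{cyc}(\pi)}q^{\mathrm{inv}(\pi)}z^{|\pi|}=J_{\mathbf d,\boldsymbol\ell}(z)$ with $d_h=vtq^{2h-1}[h]_{q^2}$ for $h\ge1$ and $\ell_h=xtq^{2h}$ for $h\ge0$; (2) $\displaystyle\sum_{\pi\ 321\text{-avoiding involution}} x^{\mathrm{fp}(\pi)}v^{\mathrm{exc}(\pi)}t^{\mathrm{cyc}(\pi)}q^{\mathrm{inv}(\pi)}z^{|\pi|}=J_{\mathbf d,\boldsymbol\ell}(z)$ with $d_h=vtq^{2h-1}$ for $h\ge1$, $\ell_0=xt$, and $\ell_h=0$ for $h\ge1$. Both sums run over all such permutations of all lengths $n\ge0$. -/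

import Mathlib

open PowerSeries

namespace PermJFraction

section Statistics

variable {n : ℕ}

/-- The number of fixed points of `π`. -/
def fp (π : Equiv.Perm (Fin n)) : ℕ := (Finset.univ.filter fun i => π i = i).card

/-- The number of excedances of `π`, that is, of values `π i` with `i < π i`. -/
def exc (π : Equiv.Perm (Fin n)) : ℕ := (Finset.univ.filter fun i => i < π i).card

/-- The number of double excedances of `π`, that is, of values `π i` with `i < π i < π (π i)`. -/
def dexc (π : Equiv.Perm (Fin n)) : ℕ :=
  (Finset.univ.filter fun i => i < π i ∧ π i < π (π i)).card

/-- The number of cycles of `π`, fixed points included: the number of parts of the partition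
of `n` formed by the lengths of all cycles. -/
def cyc (π : Equiv.Perm (Fin n)) : ℕ := Multiset.card π.partition.parts

/-- The number of inversions of `π`: pairs of positions `i < j` with `π j < π i`. -/
def inv (π : Equiv.Perm (Fin n)) : ℕ :=
  (Finset.univ.filter fun p : Fin n × Fin n => p.1 < p.2 ∧ π p.2 < π p.1).card

/-- `π` is an involution: it is equal to its inverse (the identity is allowed). -/
def IsInvolution (π : Equiv.Perm (Fin n)) : Prop := π⁻¹ = π

/-- `π` avoids the classical pattern `σ`: no subsequence of `π` is in the same relative order
as `σ`. -/
def Avoids {m : ℕ} (π : Equiv.Perm (Fin n)) (σ : Equiv.Perm (Fin m)) : Prop :=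
  ¬ ∃ f : Fin m → Fin n, StrictMono f ∧ ∀ a b, π (f a) < π (f b) ↔ σ a < σ b

end Statistics

/-- The permutation `321`, which reverses the order of three points. -/
def pattern321 : Equiv.Perm (Fin 3) := Fin.revPerm

section Series

variable {R : Type*} [CommRing R]

open Classical in
/-- `∑ x ^ fp π * v ^ exc π * t ^ cyc π * q ^ inv π * z ^ n`, summed over all `n ≥ 0` and all
permutations `π` of `n` points that satisfy `P`, as a formal power series in `z`. -/
noncomputable def genFun (P : ∀ n : ℕ, Equiv.Perm (Fin n) → Prop) (x v t q : R) : PowerSeries R :=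
  PowerSeries.mk fun n =>
    ∑ π ∈ (Finset.univ : Finset (Equiv.Perm (Fin n))).filter (fun π => P n π),
      x ^ fp π * v ^ exc π * t ^ cyc π * q ^ inv π

/-- The `q`-integer `[h]_q = 1 + q + ⋯ + q ^ (h - 1)`. -/
def qInt (h : ℕ) (q : R) : R := ∑ i ∈ Finset.range h, q ^ i

/-- The finite J-fraction
`1 / (1 - l_h z - d_{h+1} z² / (1 - l_{h+1} z - ⋯ - d_{h+N} z² / (1 - l_{h+N} z)))`.
Each denominator has constant coefficient `1` and `invOfUnit _ 1` is its inverse. -/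
noncomputable def jConvergent (d l : ℕ → R) : ℕ → ℕ → PowerSeries R
  | 0, h => invOfUnit (1 - C (l h) * X) 1
  | N + 1, h => invOfUnit (1 - C (l h) * X - C (d (h + 1)) * X ^ 2 * jConvergent d l N (h + 1)) 1

/-- The infinite J-fraction
`J_{d,l}(z) = 1 / (1 - l_0 z - d_1 z² / (1 - l_1 z - d_2 z² / (1 - l_2 z - ⋯)))`,
the coefficientwise limit of its convergents. The coefficient of `z ^ n` is constant from the
`n`-th convergent on (`coeff_jConvergent`). The value `d 0` is not used. -/
noncomputable def jFraction (d l : ℕ → R) : PowerSeries R :=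
  PowerSeries.mk fun n => coeff n (jConvergent d l n 0)

lemma X_pow_dvd_invOfUnit_sub {a b : PowerSeries R} (ha : constantCoeff a = 1)
    (hb : constantCoeff b = 1) {k : ℕ} (h : X ^ k ∣ b - a) :
    X ^ k ∣ invOfUnit a 1 - invOfUnit b 1 := by
  have h1 : a * invOfUnit a 1 = 1 := mul_invOfUnit a 1 (by simpa using ha)
  have h2 : b * invOfUnit b 1 = 1 := mul_invOfUnit b 1 (by simpa using hb)
  have : invOfUnit a 1 - invOfUnit b 1 = (b - a) * (invOfUnit a 1 * invOfUnit b 1) := by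
    linear_combination (invOfUnit b 1) * h1 - (invOfUnit a 1) * h2
  rw [this]
  exact h.mul_right _

lemma X_pow_dvd_jConvergent_sub (d l : ℕ → R) (N M : ℕ) (hNM : N ≤ M) (h : ℕ) :
    X ^ (N + 1) ∣ jConvergent d l N h - jConvergent d l M h := by
  induction N generalizing M h with
  | zero =>
    rw [X_pow_dvd_iff]
    intro m hm
    obtain rfl : m = 0 := by omega
    cases M <;> simp [jConvergent]
  | succ N ih =>
    obtain ⟨M, rfl⟩ : ∃ M', M = M' + 1 := ⟨M - 1, by omega⟩
    simp only [jConvergent]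
    apply X_pow_dvd_invOfUnit_sub (by simp) (by simp)
    obtain ⟨c, hc⟩ := ih M (by omega) (h + 1)
    exact ⟨C (d (h + 1)) * X * c, by linear_combination C (d (h + 1)) * X ^ 2 * hc⟩

/-- The convergents converge coefficientwise to `jFraction d l`. -/
theorem coeff_jConvergent (d l : ℕ → R) {n N : ℕ} (h : n ≤ N) :
    coeff n (jConvergent d l N 0) = coeff n (jFraction d l) := by
  have := X_pow_dvd_iff.1 (X_pow_dvd_jConvergent_sub d l n N h 0) n (by omega)
  rw [map_sub, sub_eq_zero] at this
  rw [jFraction, coeff_mk, this]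

end Series

end PermJFraction

/-! The coefficient of `z ^ n` in a J-fraction counts weighted Motzkin paths of length `n`, so it
suffices to read an involution point by point as such a path. Its height is the number of arcs
currently open; each point opens an arc, is fixed, or closes one of the open arcs.

The inversions are refined by nestings, marked by `p`. A fixed point under `h` open arcs creates
`2h` inversions and `h` nestings, hence the level weight `x (q²p)^h`. Closing the open arc with `r`
open arcs to its left, among `h`, creates `2h - 1 + 2r` inversions and `r` nestings; summing over
`r` gives the down weight `v q^(2h-1) [h]_{q²p}`. The counts are in `weightOn_insert_fixed` and
`weightOn_insert_arc`, and `sum_openInvolutions_eq_motzkin` runs the induction.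

In an involution `cyc = fp + exc`, so `t` is absorbed into `x` and `v`. Setting `p = 1` forgets
nestings and gives (1); setting `p = 0` keeps only the involutions without nestings, which are the
321-avoiding ones, and gives (2). -/

namespace PermJFraction

/-! ### J-fractions as generating functions of Motzkin paths -/

section MotzkinPaths

variable {R : Type*} [CommRing R]

/-- The weighted number of Motzkin paths with `n` steps from height `h` down to height `0`; up steps
have weight `1`, level steps at height `h` weight `l h`, down steps from height `h` weight `d h`. -/
def motzkin (d l : ℕ → R) : ℕ → ℕ → R
  | 0, 0 => 1
  | 0, _ + 1 => 0
  | n + 1, 0 => motzkin d l n 1 + l 0 * motzkin d l n 0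
  | n + 1, h + 1 =>
    motzkin d l n (h + 2) + l (h + 1) * motzkin d l n (h + 1) + d (h + 1) * motzkin d l n h

/-- The value `d 0` does not matter. -/
lemma motzkin_congr {d d' l : ℕ → R} (hd : ∀ h, d (h + 1) = d' (h + 1)) (n h : ℕ) :
    motzkin d l n h = motzkin d' l n h := by
  induction n generalizing h with
  | zero => cases h <;> rfl
  | succ n ih => cases h <;> simp only [motzkin, ih, hd]

/-- The tail of the J-fraction that starts at level `h`. -/
noncomputable def jTail (d l : ℕ → R) (h : ℕ) : PowerSeries R :=
  PowerSeries.mk fun n => coeff n (jConvergent d l n h)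

lemma X_pow_dvd_jTail_sub (d l : ℕ → R) (N h : ℕ) :
    X ^ (N + 1) ∣ jTail d l h - jConvergent d l N h := by
  rw [X_pow_dvd_iff]
  intro m hm
  have := X_pow_dvd_iff.1 (X_pow_dvd_jConvergent_sub d l m N (by omega) h) m (by omega)
  rwa [map_sub, jTail, coeff_mk, ← map_sub]

/-- Modulo `X ^ (n + 1)` both sides agree with the convergent of depth `n + 1`, so the recursion of
the convergents passes to the limit. -/
lemma jTail_eq_invOfUnit (d l : ℕ → R) (h : ℕ) :
    jTail d l h =
      invOfUnit (1 - C (l h) * X - C (d (h + 1)) * X ^ 2 * jTail d l (h + 1)) 1 := by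
  ext n
  rw [← sub_eq_zero, ← map_sub]
  refine X_pow_dvd_iff.1 (?_ : X ^ (n + 1) ∣ _) n (by omega)
  have h1 : X ^ (n + 1) ∣ jTail d l h - jConvergent d l (n + 1) h :=
    (pow_dvd_pow X (by omega)).trans (X_pow_dvd_jTail_sub d l (n + 1) h)
  have h2 : X ^ (n + 1) ∣ jConvergent d l (n + 1) h -
      invOfUnit (1 - C (l h) * X - C (d (h + 1)) * X ^ 2 * jTail d l (h + 1)) 1 := by
    simp only [jConvergent]
    apply X_pow_dvd_invOfUnit_sub (by simp) (by simp)
    obtain ⟨c, hc⟩ := X_pow_dvd_jTail_sub d l n (h + 1)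
    exact ⟨-C (d (h + 1)) * X ^ 2 * c, by linear_combination -C (d (h + 1)) * X ^ 2 * hc⟩
  simpa using dvd_add h1 h2

lemma jTail_eq (d l : ℕ → R) (h : ℕ) :
    jTail d l h = 1 + C (l h) * X * jTail d l h
      + C (d (h + 1)) * X ^ 2 * jTail d l (h + 1) * jTail d l h := by
  have := mul_invOfUnit (1 - C (l h) * X - C (d (h + 1)) * X ^ 2 * jTail d l (h + 1)) 1 (by simp)
  rw [← jTail_eq_invOfUnit] at this
  linear_combination this

/-- The generating function of the Motzkin paths from height `h` to height `0`. -/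
noncomputable def motzkinSeries (d l : ℕ → R) : ℕ → PowerSeries R
  | 0 => jTail d l 0
  | h + 1 => C (d (h + 1)) * X * jTail d l (h + 1) * motzkinSeries d l h

lemma motzkinSeries_zero_eq (d l : ℕ → R) :
    motzkinSeries d l 0 = 1 + X * (motzkinSeries d l 1 + C (l 0) * motzkinSeries d l 0) := by
  simp only [motzkinSeries]
  linear_combination jTail_eq d l 0

/-- The definition splits a path at its first descent to height `h`, while this equation splits it
at its first step; the tail equation at level `h + 1` reconciles the two. -/
lemma motzkinSeries_succ_eq (d l : ℕ → R) (h : ℕ) :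
    motzkinSeries d l (h + 1) = X * (motzkinSeries d l (h + 2)
      + C (l (h + 1)) * motzkinSeries d l (h + 1) + C (d (h + 1)) * motzkinSeries d l h) := by
  simp only [motzkinSeries]
  linear_combination C (d (h + 1)) * X * motzkinSeries d l h * jTail_eq d l (h + 1)

lemma coeff_motzkinSeries (d l : ℕ → R) (n h : ℕ) :
    coeff n (motzkinSeries d l h) = motzkin d l n h := by
  induction n generalizing h with
  | zero =>
    cases h with
    | zero => rw [motzkinSeries_zero_eq]; simp [motzkin]
    | succ h => rw [motzkinSeries_succ_eq]; simp [motzkin]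
  | succ n ih =>
    cases h with
    | zero =>
      rw [motzkinSeries_zero_eq, map_add, coeff_succ_X_mul]
      simp [motzkin, ih, coeff_one]
    | succ h =>
      rw [motzkinSeries_succ_eq, coeff_succ_X_mul]
      simp [motzkin, ih]

theorem coeff_jFraction (d l : ℕ → R) (n : ℕ) :
    coeff n (jFraction d l) = motzkin d l n 0 :=
  coeff_motzkinSeries d l n 0

end MotzkinPaths

/-! ### Involutions with open arcs, sorted by the role of the next point -/

section OpenInvolutions

open Finset

variable {α : Type*} [Fintype α] [LinearOrder α]

/-- The involutions with all nontrivial arcs inside `L ∪ M` that map `L` into `M`. -/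
def openInvolutions (L M : Finset α) : Finset (Equiv.Perm α) :=
  univ.filter fun π => (∀ i, π (π i) = i) ∧ (∀ i, i ∉ L ∪ M → π i = i) ∧ ∀ i ∈ L, π i ∈ M

lemma mem_openInvolutions {L M : Finset α} {π : Equiv.Perm α} :
    π ∈ openInvolutions L M ↔
      (∀ i, π (π i) = i) ∧ (∀ i, i ∉ L ∪ M → π i = i) ∧ ∀ i ∈ L, π i ∈ M := by
  simp [openInvolutions]

lemma apply_mem_of_mem_openInvolutions {L M : Finset α} {π : Equiv.Perm α}
    (hπ : π ∈ openInvolutions L M) {i : α} (hi : i ∈ L ∪ M) : π i ∈ L ∪ M := by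
  rw [mem_openInvolutions] at hπ
  by_contra h
  have := hπ.2.1 _ h
  rw [hπ.1] at this
  exact h (this ▸ hi)

variable {L M : Finset α} {m : α}

/-- If `m` is matched into `M`, no point of `L` can be its partner, so all of `L` is still matched
into `M`. -/
lemma openInvolutions_opener (hLM : Disjoint L (insert m M)) :
    (openInvolutions L (insert m M)).filter (fun π => π m ∈ M)
      = openInvolutions (insert m L) M := by
  ext π
  simp only [mem_filter, mem_openInvolutions, union_insert, insert_union, forall_mem_insert]
  constructor
  · rintro ⟨⟨h1, h2, h3⟩, h4⟩
    refine ⟨h1, h2, h4, fun i hi => ?_⟩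
    rcases mem_insert.1 (h3 i hi) with h | h
    · exfalso
      rw [← h, h1] at h4
      exact disjoint_left.1 hLM hi (mem_insert_of_mem h4)
    · exact h
  · rintro ⟨h1, h2, h3, h4⟩
    exact ⟨⟨h1, h2, fun i hi => mem_insert_of_mem (h4 i hi)⟩, h3⟩

lemma openInvolutions_fixed (hLM : Disjoint L (insert m M)) (hm : m ∉ M) :
    (openInvolutions L (insert m M)).filter (fun π => π m = m) = openInvolutions L M := by
  have hmL : m ∉ L := fun h => disjoint_left.1 hLM h (mem_insert_self _ _)
  ext π
  simp only [mem_filter, mem_openInvolutions, union_insert]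
  constructor
  · rintro ⟨⟨h1, h2, h3⟩, h4⟩
    refine ⟨h1, fun i hi => ?_, fun i hi => ?_⟩
    · by_cases him : i = m
      · rw [him, h4]
      · exact h2 i (by simp [him, hi])
    · refine (mem_insert.1 (h3 i hi)).resolve_left fun h => ?_
      rw [← h4] at h
      exact hmL (π.injective h ▸ hi)
  · rintro ⟨h1, h2, h3⟩
    refine ⟨⟨h1, fun i hi => h2 i fun h => hi (mem_insert_of_mem h),
      fun i hi => mem_insert_of_mem (h3 i hi)⟩, h2 m ?_⟩
    simp [hmL, hm]

/-- Both `j` and `m` are fixed by `π`, so multiplying by the transposition just adds the arc between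
them. -/
lemma swap_mul_mem_openInvolutions (hLM : Disjoint L (insert m M)) (hm : m ∉ M) {j : α}
    (hj : j ∈ L) {π : Equiv.Perm α} (hπ : π ∈ openInvolutions (L.erase j) M) :
    Equiv.swap j m * π ∈ openInvolutions L (insert m M) ∧ (Equiv.swap j m * π) m = j := by
  have hmL : m ∉ L := fun h => disjoint_left.1 hLM h (mem_insert_self _ _)
  have hjM : j ∉ M := fun h => disjoint_left.1 hLM hj (mem_insert_of_mem h)
  obtain ⟨h1, h2, h3⟩ := mem_openInvolutions.1 hπ
  have hπj : π j = j := h2 j (by simp [hjM])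
  have hπm : π m = m := h2 m (by simp [hmL, hm])
  have key : ∀ i, i ≠ j → i ≠ m → (Equiv.swap j m * π) i = π i := fun i hi hi' => by
    rw [Equiv.Perm.mul_apply, Equiv.swap_apply_of_ne_of_ne]
    · intro h; exact hi (π.injective (h.trans hπj.symm))
    · intro h; exact hi' (π.injective (h.trans hπm.symm))
  have kj : (Equiv.swap j m * π) j = m := by simp [hπj]
  have km : (Equiv.swap j m * π) m = j := by simp [hπm]
  refine ⟨mem_openInvolutions.2 ⟨fun i => ?_, fun i hi => ?_, fun i hi => ?_⟩, km⟩
  · by_cases hij : i = j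
    · rw [hij, kj, km]
    by_cases him : i = m
    · rw [him, km, kj]
    rw [key i hij him, key, h1]
    · intro h; exact hij (π.injective (h.trans hπj.symm))
    · intro h; exact him (π.injective (h.trans hπm.symm))
  · simp only [union_insert, mem_insert, mem_union, not_or] at hi
    have hij : i ≠ j := fun h => hi.2.1 (h ▸ hj)
    rw [key i hij hi.1]
    exact h2 i (by simp [hi])
  · by_cases hij : i = j
    · rw [hij, kj]; exact mem_insert_self _ _
    · rw [key i hij (fun h => hmL (h ▸ hi))]
      exact mem_insert_of_mem (h3 i (mem_erase.2 ⟨hij, hi⟩))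

lemma swap_mul_mem_openInvolutions_erase (hLM : Disjoint L (insert m M)) {j : α}
    {π : Equiv.Perm α} (hπ : π ∈ openInvolutions L (insert m M)) (hπm : π m = j) :
    Equiv.swap j m * π ∈ openInvolutions (L.erase j) M := by
  have hmL : m ∉ L := fun h => disjoint_left.1 hLM h (mem_insert_self _ _)
  obtain ⟨h1, h2, h3⟩ := mem_openInvolutions.1 hπ
  have hπj : π j = m := by rw [← hπm, h1]
  have key : ∀ i, i ≠ j → i ≠ m → (Equiv.swap j m * π) i = π i := fun i hi hi' => by
    rw [Equiv.Perm.mul_apply, Equiv.swap_apply_of_ne_of_ne]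
    · intro h; exact hi' (π.injective (h.trans hπm.symm))
    · intro h; exact hi (π.injective (h.trans hπj.symm))
  have kj : (Equiv.swap j m * π) j = j := by simp [hπj]
  have km : (Equiv.swap j m * π) m = m := by simp [hπm]
  refine mem_openInvolutions.2 ⟨fun i => ?_, fun i hi => ?_, fun i hi => ?_⟩
  · by_cases hij : i = j
    · rw [hij, kj, kj]
    by_cases him : i = m
    · rw [him, km, km]
    rw [key i hij him, key, h1]
    · intro h; exact him (π.injective (h.trans hπm.symm))
    · intro h; exact hij (π.injective (h.trans hπj.symm))
  · by_cases hij : i = j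
    · rw [hij, kj]
    by_cases him : i = m
    · rw [him, km]
    rw [key i hij him]
    exact h2 i (by simpa [him, hij] using hi)
  · obtain ⟨hij, hi⟩ := mem_erase.1 hi
    rw [key i hij (fun h => hmL (h ▸ hi))]
    refine (mem_insert.1 (h3 i hi)).resolve_left fun h => ?_
    exact hij (π.injective (h.trans hπj.symm))

/-- Sorting the involutions by the role of `m`: opener, fixed point, or closer of the arc from
some `j ∈ L`. -/
theorem sum_openInvolutions_insert {R : Type*} [CommRing R] (hLM : Disjoint L (insert m M))
    (hm : m ∉ M) (f : Equiv.Perm α → R) :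
    ∑ π ∈ openInvolutions L (insert m M), f π =
      ∑ π ∈ openInvolutions (insert m L) M, f π + ∑ π ∈ openInvolutions L M, f π
        + ∑ j ∈ L, ∑ π ∈ openInvolutions (L.erase j) M, f (Equiv.swap j m * π) := by
  have hmL : m ∉ L := fun h => disjoint_left.1 hLM h (mem_insert_self _ _)
  rw [← sum_filter_add_sum_filter_not _ (fun π => π m ∈ M), openInvolutions_opener hLM,
    ← sum_filter_add_sum_filter_not ((openInvolutions L (insert m M)).filter _)
      (fun π => π m = m), add_assoc]
  congr 2
  · rw [← openInvolutions_fixed hLM hm, filter_filter]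
    refine sum_congr (filter_congr fun π _ => ?_) fun _ _ => rfl
    constructor
    · exact fun h => h.2
    · exact fun h => ⟨by rwa [h], h⟩
  · rw [filter_filter, ← sum_fiberwise_of_maps_to (t := L) (g := fun π => π m)]
    · refine sum_congr rfl fun j hj => ?_
      refine sum_bij' (fun π _ => Equiv.swap j m * π) (fun π _ => Equiv.swap j m * π) ?_ ?_ ?_ ?_ ?_
      · intro π hπ
        simp only [mem_filter] at hπ
        exact swap_mul_mem_openInvolutions_erase hLM hπ.1.1 hπ.2
      · intro π hπ
        obtain ⟨h1, h2⟩ := swap_mul_mem_openInvolutions hLM hm hj hπ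
        simp only [mem_filter]
        refine ⟨⟨h1, ?_, ?_⟩, h2⟩ <;> rw [h2]
        · exact fun h => disjoint_left.1 hLM hj (mem_insert_of_mem h)
        · exact fun h => hmL (h ▸ hj)
      · intro π _; simp
      · intro π _; simp
      · intro π _; simp
    -- In the remaining case `m` is neither fixed nor sent into `M`, so its partner lies in `L`.
    · intro π hπ
      simp only [mem_filter] at hπ
      obtain ⟨h, h1, h2⟩ := hπ
      have := apply_mem_of_mem_openInvolutions h (i := m) (by simp)
      simp only [union_insert, mem_insert, mem_union] at this
      tauto

lemma openInvolutions_empty_empty : openInvolutions (∅ : Finset α) ∅ = {1} := by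
  ext π
  simp only [mem_openInvolutions, mem_singleton, Equiv.ext_iff]
  constructor
  · rintro ⟨-, h, -⟩ i
    exact h i (by simp)
  · intro h
    simp [h]

lemma openInvolutions_empty_right (hL : L.Nonempty) : openInvolutions L ∅ = ∅ := by
  obtain ⟨i, hi⟩ := hL
  ext π
  simp only [mem_openInvolutions, notMem_empty, iff_false]
  rintro ⟨-, -, h⟩
  exact h i hi

/-- Weights on open involutions that are multiplied by a factor whenever a fixed point or an arc is
inserted sum up to weighted numbers of Motzkin paths. -/
theorem sum_openInvolutions_eq_motzkin {R : Type*} [CommRing R] (d l : ℕ → R)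
    (W : Finset α → Equiv.Perm α → R) (c : Finset α → α → R) (hW : W ∅ 1 = 1)
    (hc : ∀ L : Finset α, L.Nonempty → ∑ j ∈ L, c L j = d L.card)
    (hfix : ∀ (L M : Finset α) (m : α), (∀ i ∈ L, i < m) → (∀ k ∈ M, m < k) →
      ∀ π ∈ openInvolutions L M, W (insert m (L ∪ M)) π = l L.card * W (L ∪ M) π)
    (harc : ∀ (L M : Finset α) (m : α), (∀ i ∈ L, i < m) → (∀ k ∈ M, m < k) →
      ∀ j ∈ L, ∀ π ∈ openInvolutions (L.erase j) M,
        W (insert m (L ∪ M)) (Equiv.swap j m * π) = c L j * W (L.erase j ∪ M) π)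
    (L M : Finset α) (hLM : ∀ i ∈ L, ∀ k ∈ M, i < k) :
    ∑ π ∈ openInvolutions L M, W (L ∪ M) π = motzkin d l M.card L.card := by
  induction M using Finset.induction_on_min generalizing L with
  | empty =>
    rcases L.eq_empty_or_nonempty with rfl | hL
    · simp [openInvolutions_empty_empty, motzkin, hW]
    · obtain ⟨h, hh⟩ : ∃ h, L.card = h + 1 := ⟨L.card - 1, by have := hL.card_pos; omega⟩
      simp [openInvolutions_empty_right hL, motzkin, hh]
  | insert m M hm ih =>
    have hmM : m ∉ M := fun h => lt_irrefl _ (hm m h)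
    have hLm : ∀ i ∈ L, i < m := fun i hi => hLM i hi m (mem_insert_self _ _)
    have hmL : m ∉ L := fun h => lt_irrefl _ (hLm m h)
    have hdis : Disjoint L (insert m M) :=
      disjoint_left.2 fun i hi hi' => lt_irrefl _ (hLM i hi i hi')
    have hLM' : ∀ i ∈ L, ∀ k ∈ M, i < k := fun i hi k hk => hLM i hi k (mem_insert_of_mem hk)
    rw [sum_openInvolutions_insert hdis hmM, card_insert_of_notMem hmM]
    -- Opening an arc moves `m` from `M` to `L` and leaves `L ∪ M` unchanged, so the weight does not
    -- change: up steps have weight `1`.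
    have h1 := ih (insert m L) (by
      intro i hi k hk
      rcases mem_insert.1 hi with rfl | hi
      · exact hm k hk
      · exact hLM' i hi k hk)
    rw [insert_union, ← union_insert, card_insert_of_notMem hmL] at h1
    have h2 : ∑ π ∈ openInvolutions L M, W (L ∪ insert m M) π
        = l L.card * motzkin d l M.card L.card := by
      rw [← ih L hLM', mul_sum, union_insert]
      exact sum_congr rfl (hfix L M m hLm hm)
    have h3 : ∀ j ∈ L,
        ∑ π ∈ openInvolutions (L.erase j) M, W (L ∪ insert m M) (Equiv.swap j m * π)
        = c L j * motzkin d l M.card (L.card - 1) := by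
      intro j hj
      rw [← card_erase_of_mem hj, ← ih (L.erase j) (fun i hi => hLM' i (mem_of_mem_erase hi)),
        mul_sum, union_insert]
      exact sum_congr rfl (harc L M m hLm hm j hj)
    rw [h1, h2, sum_congr rfl h3, ← sum_mul]
    rcases L.eq_empty_or_nonempty with rfl | hL
    · simp [motzkin]
    · rw [hc L hL]
      obtain ⟨h, hh⟩ : ∃ h, L.card = h + 1 := ⟨L.card - 1, by have := hL.card_pos; omega⟩
      simp [motzkin, hh]

end OpenInvolutions

/-! ### Inversions and nestings created by a fixed point or an arc -/

section Weights

open Finset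

variable {α : Type*} [LinearOrder α]

/-- The number of fixed points of `π` in `A`. -/
def fpOn (A : Finset α) (π : Equiv.Perm α) : ℕ := #{i ∈ A | π i = i}

/-- The number of excedances of `π` at positions in `A`. -/
def excOn (A : Finset α) (π : Equiv.Perm α) : ℕ := #{i ∈ A | i < π i}

/-- The number of inversions of `π` at positions in `A`. -/
def invOn (A : Finset α) (π : Equiv.Perm α) : ℕ := #{p ∈ A ×ˢ A | p.1 < p.2 ∧ π p.2 < π p.1}

/-- The number of nestings of `π` at positions in `A`: pairs `i < k ≤ π k < π i`. -/
def nestOn (A : Finset α) (π : Equiv.Perm α) : ℕ :=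
  #{p ∈ A ×ˢ A | p.1 < p.2 ∧ p.2 ≤ π p.2 ∧ π p.2 < π p.1}

/-- The joint weight by fixed points, excedances, inversions and nestings. -/
def weightOn {R : Type*} [CommRing R] (x v q p : R) (A : Finset α) (π : Equiv.Perm α) : R :=
  x ^ fpOn A π * v ^ excOn A π * q ^ invOn A π * p ^ nestOn A π

lemma card_filter_insert_product {Q : α × α → Prop} [DecidablePred Q] {A : Finset α} {a : α}
    (ha : a ∉ A) (hQ : ¬ Q (a, a)) :
    #{p ∈ insert a A ×ˢ insert a A | Q p} =
      #{p ∈ A ×ˢ A | Q p} + #{i ∈ A | Q (i, a)} + #{k ∈ A | Q (a, k)} := by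
  simp only [card_filter, sum_product, sum_insert ha, sum_add_distrib, if_neg hQ]
  ring

lemma weightOn_congr {R : Type*} [CommRing R] (x v q p : R) {A : Finset α} {π σ : Equiv.Perm α}
    (h : ∀ i ∈ A, π i = σ i) : weightOn x v q p A π = weightOn x v q p A σ := by
  have h1 : fpOn A π = fpOn A σ := congrArg card (filter_congr fun i hi => by rw [h i hi])
  have h2 : excOn A π = excOn A σ := congrArg card (filter_congr fun i hi => by rw [h i hi])
  have h3 : invOn A π = invOn A σ := congrArg card (filter_congr fun i hi => by
    rw [mem_product] at hi; rw [h _ hi.1, h _ hi.2])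
  have h4 : nestOn A π = nestOn A σ := congrArg card (filter_congr fun i hi => by
    rw [mem_product] at hi; rw [h _ hi.1, h _ hi.2])
  simp only [weightOn, h1, h2, h3, h4]

/-- Reindexing by `π` reflects inversions across the diagonal. Inversions of a new point with later
positions are thereby counted like those with earlier ones, which produces the factors `2`. -/
lemma card_filter_lt_apply_comm {A : Finset α} {π : Equiv.Perm α} (hπ : ∀ i, π (π i) = i)
    (hA : ∀ i ∈ A, π i ∈ A) (a b : α) :
    #{k ∈ A | a < k ∧ π k < b} = #{i ∈ A | i < b ∧ a < π i} := by
  refine card_bij' (fun k _ => π k) (fun k _ => π k) ?_ ?_ ?_ ?_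
  · intro k hk
    simp only [mem_filter] at hk ⊢
    exact ⟨hA k hk.1, hk.2.2, by rw [hπ]; exact hk.2.1⟩
  · intro k hk
    simp only [mem_filter] at hk ⊢
    exact ⟨hA k hk.1, hk.2.2, by rw [hπ]; exact hk.2.1⟩
  · intro k _; exact hπ k
  · intro k _; exact hπ k

/-- The exponent is the rank of `j` in `L`, which runs through `0, …, #L - 1`. -/
lemma sum_pow_card_lt_eq_qInt {R : Type*} [CommRing R] (p : R) (L : Finset α) :
    ∑ j ∈ L, p ^ #{i ∈ L | i < j} = qInt #L p := by
  induction L using Finset.induction_on_max with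
  | empty => simp [qInt]
  | insert a L ha ih =>
    have haL : a ∉ L := fun h => lt_irrefl _ (ha a h)
    rw [sum_insert haL, card_insert_of_notMem haL, qInt, sum_range_succ, ← qInt, ← ih, add_comm]
    congr 1
    · refine sum_congr rfl fun j hj => ?_
      rw [filter_insert, if_neg (ha j hj).not_gt]
    · rw [filter_insert, if_neg (lt_irrefl _), filter_true_of_mem ha]

variable [Fintype α] {L M : Finset α} {m : α} {π : Equiv.Perm α}

/-- The arcs passing over `m` are exactly the `#L` arcs that start in `L`; each gives two
inversions, one per endpoint, and one nesting. -/
lemma weightOn_insert_fixed {R : Type*} [CommRing R] (x v q p : R) (hL : ∀ i ∈ L, i < m)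
    (hM : ∀ k ∈ M, m < k) (hπ : π ∈ openInvolutions L M) :
    weightOn x v q p (insert m (L ∪ M)) π
      = x * (q ^ 2 * p) ^ #L * weightOn x v q p (L ∪ M) π := by
  have hm : m ∉ L ∪ M := by
    intro h
    rcases mem_union.1 h with h | h
    · exact lt_irrefl _ (hL m h)
    · exact lt_irrefl _ (hM m h)
  obtain ⟨h1, h2, h3⟩ := mem_openInvolutions.1 hπ
  have hA := fun i (hi : i ∈ L ∪ M) => apply_mem_of_mem_openInvolutions hπ hi
  have hπm := h2 m hm
  have hcount : #{i ∈ L ∪ M | i < m ∧ m < π i} = #L := by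
    congr 1
    ext i
    simp only [mem_filter, mem_union]
    constructor
    · rintro ⟨h | h, h', -⟩
      · exact h
      · exact absurd h' (hM i h).not_gt
    · exact fun h => ⟨Or.inl h, hL i h, hM _ (h3 i h)⟩
  have hfp : fpOn (insert m (L ∪ M)) π = fpOn (L ∪ M) π + 1 := by
    rw [fpOn, filter_insert, if_pos hπm, card_insert_of_notMem (by simp [hm])]; rfl
  have hexc : excOn (insert m (L ∪ M)) π = excOn (L ∪ M) π := by
    rw [excOn, filter_insert, if_neg (by simp [hπm])]; rfl
  have hinv : invOn (insert m (L ∪ M)) π = invOn (L ∪ M) π + 2 * #L := by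
    rw [invOn, card_filter_insert_product hm (by simp)]
    simp only [hπm]
    rw [card_filter_lt_apply_comm h1 hA, hcount, invOn]
    ring
  have hnest : nestOn (insert m (L ∪ M)) π = nestOn (L ∪ M) π + #L := by
    rw [nestOn, card_filter_insert_product hm (by simp)]
    simp only [hπm, le_refl, true_and]
    rw [hcount, nestOn, add_eq_left, card_eq_zero, filter_eq_empty_iff]
    rintro k - ⟨h, h', h''⟩
    exact lt_irrefl _ (h.trans_le h' |>.trans h'')
  simp only [weightOn, hfp, hexc, hinv, hnest]
  ring

/-- The new arc is itself one inversion. Each of the other `#L - 1` open arcs crosses or encloses it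
and gives two; those starting before `j` enclose it and give two more and a nesting. -/
lemma weightOn_insert_arc {R : Type*} [CommRing R] (x v q p : R) (hL : ∀ i ∈ L, i < m)
    (hM : ∀ k ∈ M, m < k) {j : α} (hj : j ∈ L) (hπ : π ∈ openInvolutions (L.erase j) M) :
    weightOn x v q p (insert m (L ∪ M)) (Equiv.swap j m * π)
      = v * q ^ (2 * #L - 1) * (q ^ 2 * p) ^ #{i ∈ L | i < j}
        * weightOn x v q p (L.erase j ∪ M) π := by
  have hmL : m ∉ L := fun h => lt_irrefl _ (hL m h)
  have hmM : m ∉ M := fun h => lt_irrefl _ (hM m h)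
  have hjm : j < m := hL j hj
  have hjM : j ∉ M := fun h => lt_asymm hjm (hM j h)
  have hdis : Disjoint L (insert m M) := by
    refine disjoint_left.2 fun i hi hi' => ?_
    rcases mem_insert.1 hi' with rfl | h
    · exact hmL hi
    · exact lt_asymm (hL i hi) (hM i h)
  obtain ⟨hσ, hσm⟩ := swap_mul_mem_openInvolutions hdis hmM hj hπ
  obtain ⟨h1, h2, h3⟩ := mem_openInvolutions.1 hπ
  have hA := fun i (hi : i ∈ L.erase j ∪ M) => apply_mem_of_mem_openInvolutions hπ hi
  have hjA : j ∉ L.erase j ∪ M := by simp [hjM]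
  have hmA : m ∉ insert j (L.erase j ∪ M) := by simp [hmL, hmM, hjm.ne']
  have hAm : ∀ i ∈ L.erase j ∪ M, (Equiv.swap j m * π) i = π i := by
    intro i hi
    have := hA i hi
    refine Equiv.swap_apply_of_ne_of_ne (fun h => hjA (h ▸ this)) fun h => hmA ?_
    exact mem_insert_of_mem (h ▸ this)
  have hins : insert m (L ∪ M) = insert m (insert j (L.erase j ∪ M)) := by
    rw [← insert_union j, insert_erase hj]
  rw [hins, ← weightOn_congr x v q p hAm]
  have hσ1 := (mem_openInvolutions.1 hσ).1
  have hσA : ∀ i ∈ L.erase j ∪ M, (Equiv.swap j m * π) i ∈ L.erase j ∪ M := by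
    intro i hi; rw [hAm i hi]; exact hA i hi
  have hσL : ∀ i ∈ L.erase j, (Equiv.swap j m * π) i ∈ M := by
    intro i hi; rw [hAm i (mem_union_left _ hi)]; exact h3 i hi
  generalize Equiv.swap j m * π = σ at *
  have hσj : σ j = m := by rw [← hσm, hσ1]
  have hL1 : #L = #(L.erase j) + 1 := (card_erase_add_one hj).symm
  have c1 : #{i ∈ L.erase j ∪ M | i < j ∧ m < σ i} = #{i ∈ L | i < j} := by
    congr 1
    ext i
    simp only [mem_filter, mem_union]
    constructor
    · rintro ⟨h | h, h', -⟩
      · exact ⟨mem_of_mem_erase h, h'⟩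
      · exact absurd (h'.trans hjm) (hM i h).not_gt
    · rintro ⟨h, h'⟩
      have := mem_erase.2 ⟨h'.ne, h⟩
      exact ⟨Or.inl this, h', hM _ (hσL i this)⟩
  have c2 : #{i ∈ L.erase j ∪ M | i < m ∧ j < σ i} = #(L.erase j) := by
    congr 1
    ext i
    simp only [mem_filter, mem_union]
    constructor
    · rintro ⟨h | h, h', -⟩
      · exact h
      · exact absurd h' (hM i h).not_gt
    · exact fun h => ⟨Or.inl h, hL i (mem_of_mem_erase h), hjm.trans (hM _ (hσL i h))⟩
  have hfp : fpOn (insert m (insert j (L.erase j ∪ M))) σ = fpOn (L.erase j ∪ M) σ := by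
    rw [fpOn, filter_insert, if_neg (by simp [hσm, hjm.ne]), filter_insert,
      if_neg (by simp [hσj, hjm.ne'])]; rfl
  have hexc : excOn (insert m (insert j (L.erase j ∪ M))) σ = excOn (L.erase j ∪ M) σ + 1 := by
    rw [excOn, filter_insert, if_neg (by simp [hσm, hjm.le]), filter_insert,
      if_pos (by simp [hσj, hjm]), card_insert_of_notMem (by simp [hjM])]; rfl
  have hinv : invOn (insert m (insert j (L.erase j ∪ M))) σ
      = invOn (L.erase j ∪ M) σ + 2 * #{i ∈ L | i < j} + (2 * #L - 1) := by
    rw [invOn, card_filter_insert_product hmA (by simp),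
      card_filter_insert_product hjA (by simp)]
    simp only [hσm, hσj]
    rw [filter_insert, if_pos (by simp [hσj, hjm]), card_insert_of_notMem (by simp [hjM]),
      filter_insert, if_neg (by simp [hjm.le]), card_filter_lt_apply_comm hσ1 hσA,
      card_filter_lt_apply_comm hσ1 hσA, c1, c2, invOn]
    omega
  have hnest : nestOn (insert m (insert j (L.erase j ∪ M))) σ
      = nestOn (L.erase j ∪ M) σ + #{i ∈ L | i < j} := by
    rw [nestOn, card_filter_insert_product hmA (by simp),
      card_filter_insert_product hjA (by simp)]
    simp only [hσm, hσj, hjm.le, true_and]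
    rw [c1, nestOn, add_assoc, add_assoc, add_assoc, add_right_inj, add_eq_left]
    simp only [Nat.add_eq_zero_iff, card_eq_zero, filter_eq_empty_iff]
    -- The arc from `j` to `m` encloses nothing, since the other arcs from `L` end beyond `m` and
    -- `M` lies beyond `m`. As a closer, `m` takes part in no nesting in either place.
    refine ⟨?_, ?_, ?_⟩
    · rintro k hk ⟨-, h, h'⟩
      rcases mem_union.1 hk with hk | hk
      · exact lt_asymm h' (hM _ (hσL k hk))
      · exact lt_asymm (hM k hk) (h.trans_lt h')
    · rintro k - ⟨-, h, -⟩
      exact absurd h hjm.not_ge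
    · rintro k - ⟨h, h', h''⟩
      exact lt_asymm hjm ((h.trans_le h').trans h'')
  simp only [weightOn, hfp, hexc, hinv, hnest]
  ring

/-- The J-fraction weights count involutions by fixed points, excedances, inversions and
nestings. -/
theorem sum_weightOn_eq_motzkin {R : Type*} [CommRing R] (x v q p : R) (L M : Finset α)
    (hLM : ∀ i ∈ L, ∀ k ∈ M, i < k) :
    ∑ π ∈ openInvolutions L M, weightOn x v q p (L ∪ M) π =
      motzkin (fun h => v * q ^ (2 * h - 1) * qInt h (q ^ 2 * p))
        (fun h => x * (q ^ 2 * p) ^ h) #M #L := by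
  refine sum_openInvolutions_eq_motzkin _ _ _
    (fun L j => v * q ^ (2 * #L - 1) * (q ^ 2 * p) ^ #{i ∈ L | i < j}) ?_ ?_ ?_ ?_ L M hLM
  · simp [weightOn, fpOn, excOn, invOn, nestOn]
  · intro L _
    rw [← mul_sum, sum_pow_card_lt_eq_qInt]
  · exact fun L M m hL hM π hπ => weightOn_insert_fixed x v q p hL hM hπ
  · exact fun L M m hL hM j hj π hπ => weightOn_insert_arc x v q p hL hM hj hπ

end Weights

/-! ### Cycles and 321-avoidance of involutions -/

section Involutions

variable {n : ℕ} {π : Equiv.Perm (Fin n)}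

lemma IsInvolution.apply_apply (hπ : IsInvolution π) (i : Fin n) : π (π i) = i := by
  have h : π⁻¹ = π := hπ
  nth_rewrite 1 [← h]
  simp

lemma isInvolution_iff : IsInvolution π ↔ ∀ i, π (π i) = i := by
  refine ⟨fun h => h.apply_apply, fun h => ?_⟩
  rw [IsInvolution, _root_.inv_eq_iff_mul_eq_one]
  ext i
  simp [h]

lemma IsInvolution.dexc_eq_zero (hπ : IsInvolution π) : dexc π = 0 := by
  rw [dexc, Finset.card_eq_zero, Finset.filter_eq_empty_iff]
  rintro i - ⟨h, h'⟩
  rw [hπ.apply_apply] at h'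
  exact lt_asymm h h'

/-- The nontrivial cycles of an involution are its arcs. -/
lemma IsInvolution.cyc_eq (hπ : IsInvolution π) : cyc π = fp π + exc π := by
  classical
  have hsum : π.cycleType.sum = 2 * Multiset.card π.cycleType := by
    have h2 : ∀ a ∈ π.cycleType, a = 2 := by
      intro a ha
      have h : a ∣ 2 := (Equiv.Perm.dvd_of_mem_cycleType ha).trans
        (orderOf_dvd_of_pow_eq_one (by ext i; simp [sq, hπ.apply_apply]))
      have := Equiv.Perm.two_le_of_mem_cycleType ha
      have := Nat.le_of_dvd two_pos h
      omega
    rw [Multiset.eq_replicate_of_mem h2]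
    simp [mul_comm]
  have hlt : (Finset.univ.filter fun i => π i < i).card = exc π := by
    refine Finset.card_bij' (fun i _ => π i) (fun i _ => π i) ?_ ?_ ?_ ?_ <;>
      simp [hπ.apply_apply]
  have hsupp : π.support.card = 2 * exc π := by
    have : π.support = (Finset.univ.filter fun i => i < π i) ∪
        (Finset.univ.filter fun i => π i < i) := by
      ext i
      simp only [Equiv.Perm.mem_support, Finset.mem_union, Finset.mem_filter, Finset.mem_univ,
        true_and]
      rw [ne_iff_lt_or_gt, or_comm]
    rw [this, Finset.card_union_of_disjoint, hlt, exc, two_mul]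
    exact Finset.disjoint_filter.2 fun i _ h => h.not_gt
  have hfp : fp π + π.support.card = n := by
    have := Finset.card_filter_add_card_filter_not (s := Finset.univ) (fun i => π i = i)
    simpa [fp, Equiv.Perm.support] using this
  rw [cyc, Equiv.Perm.parts_partition, Multiset.card_add, Multiset.card_replicate]
  rw [Equiv.Perm.sum_cycleType] at hsum
  rw [Fintype.card_fin]
  omega

/-- An involution avoids `321` if and only if it has no nestings. -/
lemma IsInvolution.avoids_pattern321_iff (hπ : IsInvolution π) :
    Avoids π pattern321 ↔ nestOn Finset.univ π = 0 := by
  have happ := hπ.apply_apply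
  have hnest : nestOn Finset.univ π = 0 ↔ ∀ i k, i < k → k ≤ π k → ¬ π k < π i := by
    simp [nestOn, Finset.filter_eq_empty_iff]
  have havoid : Avoids π pattern321 ↔ ¬ ∃ a b c, a < b ∧ b < c ∧ π c < π b ∧ π b < π a := by
    refine not_congr ⟨?_, ?_⟩
    · rintro ⟨f, hf, h⟩
      refine ⟨f 0, f 1, f 2, hf (by decide), hf (by decide), ?_, ?_⟩ <;> rw [h] <;> decide
    · rintro ⟨a, b, c, hab, hbc, h1, h2⟩
      refine ⟨![a, b, c], ?_, ?_⟩
      · rw [Fin.strictMono_iff_lt_succ]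
        intro i
        fin_cases i
        · exact hab
        · exact hbc
      · have h3 := h1.trans h2
        intro i k
        fin_cases i <;> fin_cases k <;>
          simp [pattern321, h1, h2, h3, h1.le, h2.le, h3.le]
  rw [havoid, hnest]
  constructor
  · intro h i k hik hk hki
    apply h
    -- A fixed point under an arc is the middle of a 321 whose outer entries are the ends of the
    -- arc; for nested arcs, the two openers and the inner closer form a 321.
    rcases hk.eq_or_lt with hk | hk
    · exact ⟨i, k, π i, hik, by rwa [← hk] at hki, by rwa [happ, ← hk], hki⟩
    · exact ⟨i, k, π k, hik, hk, by rwa [happ], hki⟩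
  · rintro h ⟨a, b, c, hab, hbc, h1, h2⟩
    rcases le_or_gt b (π b) with hb | hb
    · exact h a b hab hb h2
    -- Here `π b < b`, so the inversion at `b < c` is reflected: `π c < π b < b < c` is a nesting.
    · exact h (π c) (π b) h1 (by rw [happ]; exact hb.le) (by rwa [happ, happ])

end Involutions

/-! ### Specialization to `p = 1` and `p = 0` -/

section GeneratingFunctions

variable {R : Type*} [CommRing R]

lemma openInvolutions_empty_univ (n : ℕ) :
    openInvolutions (∅ : Finset (Fin n)) Finset.univ
      = Finset.univ.filter fun π : Equiv.Perm (Fin n) => ∀ i, π (π i) = i := by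
  ext π
  simp [mem_openInvolutions]

lemma IsInvolution.weight_eq {n : ℕ} {π : Equiv.Perm (Fin n)} (hπ : IsInvolution π)
    (x v t q p : R) :
    weightOn (x * t) (v * t) q p Finset.univ π
      = x ^ fp π * v ^ exc π * t ^ cyc π * q ^ inv π * p ^ nestOn Finset.univ π := by
  have h1 : fpOn Finset.univ π = fp π := rfl
  have h2 : excOn Finset.univ π = exc π := rfl
  have h3 : invOn Finset.univ π = inv π := by rw [invOn, inv, Finset.univ_product_univ]
  rw [weightOn, h1, h2, h3, hπ.cyc_eq]
  ring

lemma coeff_jFraction_eq_sum (x v t q p : R) (n : ℕ) :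
    coeff n (jFraction (fun h => v * t * q ^ (2 * h - 1) * qInt h (q ^ 2 * p))
        (fun h => x * t * (q ^ 2 * p) ^ h)) =
      ∑ π ∈ Finset.univ.filter (fun π : Equiv.Perm (Fin n) => ∀ i, π (π i) = i),
        x ^ fp π * v ^ exc π * t ^ cyc π * q ^ inv π * p ^ nestOn Finset.univ π := by
  have := sum_weightOn_eq_motzkin (x * t) (v * t) q p (∅ : Finset (Fin n)) Finset.univ (by simp)
  rw [Finset.empty_union, openInvolutions_empty_univ, Finset.card_empty, Finset.card_univ,
    Fintype.card_fin] at this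
  rw [coeff_jFraction, ← this]
  refine Finset.sum_congr rfl fun π hπ => ?_
  exact (isInvolution_iff.2 (Finset.mem_filter.1 hπ).2).weight_eq x v t q p

theorem genFun_isInvolution (x v t q : R) :
    genFun (fun _ π => IsInvolution π) x v t q =
      jFraction (fun h => v * t * q ^ (2 * h - 1) * qInt h (q ^ 2))
        (fun h => x * t * q ^ (2 * h)) := by
  classical
  ext n
  have := coeff_jFraction_eq_sum x v t q 1 n
  simp only [mul_one, one_pow, ← pow_mul] at this
  rw [this, genFun, coeff_mk]
  exact Finset.sum_congr (Finset.filter_congr fun π _ => isInvolution_iff) fun _ _ => rfl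

theorem genFun_isInvolution_avoids (x v t q : R) :
    genFun (fun _ π => IsInvolution π ∧ Avoids π pattern321) x v t q =
      jFraction (fun h => v * t * q ^ (2 * h - 1)) (fun h => if h = 0 then x * t else 0) := by
  classical
  -- At `p = 0` the convention `0 ^ 0 = 1` keeps the level weight at height `0` and kills all
  -- others.
  have hl : (fun h => if h = 0 then x * t else 0) = fun h => x * t * (q ^ 2 * 0) ^ h := by
    funext h
    cases h <;> simp
  -- `qInt h 0` is `1` for `h ≥ 1` but `0` for `h = 0`, so the two weight sequences may differ at
  -- the irrelevant index `0`.
  have hd : ∀ n, coeff n (jFraction (fun h => v * t * q ^ (2 * h - 1))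
        (fun h => x * t * (q ^ 2 * 0) ^ h))
      = coeff n (jFraction (fun h => v * t * q ^ (2 * h - 1) * qInt h (q ^ 2 * 0))
        (fun h => x * t * (q ^ 2 * 0) ^ h)) := by
    intro n
    rw [coeff_jFraction, coeff_jFraction]
    refine motzkin_congr ?_ n 0
    intro h
    simp [qInt, Finset.sum_range_succ']
  ext n
  rw [hl, hd, coeff_jFraction_eq_sum, genFun, coeff_mk]
  simp only [← isInvolution_iff]
  rw [Finset.sum_filter, Finset.sum_filter]
  refine Finset.sum_congr rfl fun π _ => ?_
  by_cases hπ : IsInvolution π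
  · by_cases h : nestOn Finset.univ π = 0
    · rw [if_pos ⟨hπ, hπ.avoids_pattern321_iff.2 h⟩, if_pos hπ, h, pow_zero, mul_one]
    · rw [if_neg fun h' => h (hπ.avoids_pattern321_iff.1 h'.2), if_pos hπ, zero_pow h, mul_zero]
  · rw [if_neg fun h' => hπ h'.1, if_neg hπ]

end GeneratingFunctions

end PermJFraction

theorem mainTheorem12 {R : Type*} [CommRing R] (x v t q : R) :
    (∀ (n : ℕ) (π : Equiv.Perm (Fin n)),
      PermJFraction.IsInvolution π → PermJFraction.dexc π = 0) ∧
    PermJFraction.genFun (fun _ π => PermJFraction.IsInvolution π) x v t q =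
      PermJFraction.jFraction
        (fun h => v * t * q ^ (2 * h - 1) * PermJFraction.qInt h (q ^ 2))
        (fun h => x * t * q ^ (2 * h)) ∧
    PermJFraction.genFun
        (fun _ π => PermJFraction.IsInvolution π ∧
          PermJFraction.Avoids π PermJFraction.pattern321) x v t q =
      PermJFraction.jFraction
        (fun h => v * t * q ^ (2 * h - 1))
        (fun h => if h = 0 then x * t else 0) :=
  ⟨fun _ _ hπ => hπ.dexc_eq_zero, PermJFraction.genFun_isInvolution x v t q,
    PermJFraction.genFun_isInvolution_avoids x v t q⟩
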